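/- A JB$^*$-triple is a complex Banach space $E$ equipped with a triple product $\{\cdot,\cdot,\cdot\}:E\times E\times E\to E$ that is linear and symmetric in the outer variables and conjugate linear in the middle one, and such that: (1) $\{a,b,\{x,y,z\}\}=\{\{a,b,x\},y,z\}-\{x,\{b,a,y\},z\}+\{x,y,\{a,b,z\}\}$ for all $a,b,x,y,z\in E$; (2) for every $a\in E$ the operator $L(a,a):x\mapsto\{a,a,x\}$ is a bounded hermitian operator on $E$ (that is, $\exp(itL(a,a))$ is an isometry for every $t\in\mathbb{R}$) with non-negative spectrum; (3) $\|\{x,x,x\}\|=\|x\|^3$ for all $x\in E$. For $a\in E$ write $Q(a)(x)=\{a,x,a\}$, $a^{[1]}=a$ and $a^{[2n+1]}=\{a,a^{[2n-1]},a\}$ for $n\ge 1$. The JB$^*$-subtriple generated by $a$ is the smallest norm-closed complex subspace of $E$ that contains $a$ and is closed under the triple product. **Lemma.** Let $E$ be a JB$^*$-triple, let $e\in E$ be a tripotent, i.e. $\{e,e,e\}=e$, and let $a$ lie in the Peirce-1 subspace $E_1(e)=\{x\in E:\{e,e,x\}=\tfrac12 x\}$. Suppose that $\{a,a,e\}=0$.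 Then $\{b,c,e\}=0$ and $Q(b)Q(c)(e)=0$ for all $b,c$ in the JB$^*$-subtriple of $E$ generated by $a$. In particular, $\{a^{[3]},e,a^{[3]}\}=0$. -/

import Mathlib

/-- A bounded linear operator `T` on a complex Banach space is *hermitian* if `exp (i t T)` is an
isometry for every real `t` (equivalently, if its numerical range consists of real numbers). -/
def IsHermitianOperator {E : Type*} [NormedAddCommGroup E] [NormedSpace ℂ E]
    (T : E →L[ℂ] E) : Prop :=
  ∀ t : ℝ, Isometry (NormedSpace.exp ((Complex.I * (t : ℂ)) • T) : E →L[ℂ] E)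

/-- A *JB\*-triple*: a complex Banach space with a triple product `{x, y, z} = triple x y z`,
linear and symmetric in the outer variables and conjugate linear in the middle one, satisfying the
Jordan identity, such that every `L(a, a) = {a, a, ·}` is a (bounded) hermitian operator with
non-negative spectrum, and such that `‖{x, x, x}‖ = ‖x‖ ^ 3`. -/
class JBStarTriple (E : Type*) [NormedAddCommGroup E] [NormedSpace ℂ E] [CompleteSpace E] where
  /-- The triple product. -/
  triple : E →ₗ[ℂ] E →ₗ⋆[ℂ] E →ₗ[ℂ] E
  triple_symm : ∀ x y z : E, triple x y z = triple z y x
  jordan_identity : ∀ a b x y z : E,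
    triple a b (triple x y z) =
      triple (triple a b x) y z - triple x (triple b a y) z + triple x y (triple a b z)
  hermitian_nonneg : ∀ a : E, ∃ T : E →L[ℂ] E, (∀ x : E, T x = triple a a x) ∧
    IsHermitianOperator T ∧ ∀ z ∈ spectrum ℂ T, ∃ r : ℝ, 0 ≤ r ∧ z = (r : ℂ)
  norm_triple_self : ∀ x : E, ‖triple x x x‖ = ‖x‖ ^ 3

namespace JBStarTriple

variable {E : Type*} [NormedAddCommGroup E] [NormedSpace ℂ E] [CompleteSpace E] [JBStarTriple E]

/-- The operator `L(a, b) x = {a, b, x}`. -/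
def L (a b : E) : E →ₗ[ℂ] E := triple a b

/-- The (conjugate linear) map `Q(a) b = {a, b, a}`. -/
def Q (a b : E) : E := triple a b a

/-- `e` is a tripotent if `{e, e, e} = e`. -/
def IsTripotent (e : E) : Prop := triple e e e = e

/-- The Peirce-`j` subspace `E_j(e)`: the eigenspace of `L(e, e)` for the value `j / 2`. -/
noncomputable def peirce (e : E) (j : ℕ) : Submodule ℂ E := Module.End.eigenspace (L e e) ((j : ℂ) / 2)

/-- A JB\*-subtriple: a norm closed complex subspace that is closed under the triple product. -/
def IsSubtriple (S : Submodule ℂ E) : Prop :=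
  IsClosed (S : Set E) ∧ ∀ x ∈ S, ∀ y ∈ S, ∀ z ∈ S, triple x y z ∈ S

/-- The JB\*-subtriple generated by `a`: the smallest one that contains `a`. -/
def generated (a : E) : Submodule ℂ E := sInf {S : Submodule ℂ E | IsSubtriple S ∧ a ∈ S}

/-- The odd powers: `oddPow a n` is `a^[2n+1]`, where `a^[1] = a` and
`a^[2n+1] = {a, a^[2n-1], a}`. -/
def oddPow (a : E) : ℕ → E
  | 0 => a
  | n + 1 => triple a (oddPow a n) a

end JBStarTriple

open Filter Topology

/-! ### Exponential bounds and Liouville's theorem in Banach algebras -/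

section BanachAlgebra

variable {A : Type*} [NormedRing A] [NormedAlgebra ℂ A] [CompleteSpace A]

/-! The argument works for any `x` with `{a,a,x} = 0`. If a functional `f` attains its norm at `x`,
then `(b,c) ↦ f {b,c,x}` is a positive hermitian form, because each `L(b,b)` is hermitian with
non-negative spectrum; Cauchy–Schwarz then gives `f {b,a,x} = 0` for every `b`. When `b` is an odd
power of `a`, `L(b,a)` commutes with `L(a,a)`, so it acts on the closed space `ker L(a,a)` with zero
numerical range there, and on a complex Banach space such an operator is zero
(`triple_eq_zero_of_invariant`).

The Jordan identity reduces every `L(a^[2k+1], a^[2l+1])` to the form `L(b,a)` (`triple_oddPow_eq`),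
and continuity of the product passes to the generated subtriple. The `Q` statements follow
algebraically. -/

theorem norm_exp_smul_le_of_norm_pow_le {S : A} {C ρ : ℝ} (h : ∀ n, ‖S ^ n‖ ≤ C * ρ ^ n) (z : ℂ) :
    ‖NormedSpace.exp (z • S)‖ ≤ C * Real.exp (‖z‖ * ρ) := by
  have h1 := NormedSpace.exp_series_hasSum_exp' (𝕂 := ℂ) (z • S)
  have h2 : HasSum (fun n : ℕ => C * ((‖z‖ * ρ) ^ n / n.factorial)) (C * Real.exp (‖z‖ * ρ)) := by
    rw [Real.exp_eq_exp_ℝ]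
    exact (NormedSpace.expSeries_div_hasSum_exp (‖z‖ * ρ)).mul_left C
  refine h1.norm_le_of_bounded h2 fun n => ?_
  rw [smul_pow, smul_smul, norm_smul, norm_mul, norm_inv, norm_pow, RCLike.norm_natCast, mul_pow]
  calc _ ≤ ((n.factorial : ℝ)⁻¹ * ‖z‖ ^ n) * (C * ρ ^ n) := by gcongr; exact h n
    _ = _ := by ring

/-- Powers grow at most like `ρ ^ n` when `ρ` exceeds the spectral radius. -/
theorem exists_norm_pow_le_of_spectralRadius_lt {S : A} {ρ : NNReal}
    (h : spectralRadius ℂ S < ρ) : ∃ C : ℝ, ∀ n, ‖S ^ n‖ ≤ C * (ρ : ℝ) ^ n := by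
  have hρ : 0 < ρ := by
    have := bot_le.trans_lt h
    simpa using this
  have h1 : ∀ᶠ n : ℕ in atTop, ‖S ^ n‖ ≤ (ρ : ℝ) ^ n := by
    filter_upwards [(spectrum.pow_nnnorm_pow_one_div_tendsto_nhds_spectralRadius S).eventually_lt_const h,
      eventually_gt_atTop 0] with n hn hn0
    have h2 := ENNReal.rpow_le_rpow hn.le (Nat.cast_nonneg (α := ℝ) n)
    rw [← ENNReal.rpow_mul, one_div, inv_mul_cancel₀ (by positivity), ENNReal.rpow_one,
      ENNReal.rpow_natCast] at h2
    exact_mod_cast h2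
  obtain ⟨N, hN⟩ := eventually_atTop.1 h1
  refine ⟨1 + ∑ i ∈ Finset.range N, ‖S ^ i‖ / (ρ : ℝ) ^ i, fun n => ?_⟩
  have hρn : (0 : ℝ) < (ρ : ℝ) ^ n := by positivity
  have hs : ∀ i ∈ Finset.range N, 0 ≤ ‖S ^ i‖ / (ρ : ℝ) ^ i := fun i _ => by positivity
  rw [← div_le_iff₀ hρn]
  rcases lt_or_ge n N with hn | hn
  · have := Finset.single_le_sum hs (Finset.mem_range.2 hn)
    linarith
  · have := Finset.sum_nonneg hs
    have := (div_le_one hρn).2 (hN n hn)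
    linarith

/-- If every invertible `1 + z • N` has an inverse of norm at most one, then `N = 0`. -/
theorem eq_zero_of_norm_inverse_one_add_smul_le {N : A}
    (hinv : ∀ z : ℂ, IsUnit (1 + z • N) → ‖Ring.inverse (1 + z • N)‖ ≤ 1) : N = 0 := by
  nontriviality A
  -- The bound on the inverse makes the Neumann step length independent of `z`, so finitely many
  -- steps from `0` reach any point of the plane.
  have hstep (z w : ℂ) (hw : ‖w • N‖ < 1) (hz : IsUnit (1 + z • N)) :
      IsUnit (1 + (z + w) • N) := by
    have h1 : 1 + (z + w) • N = (1 + z • N) * (1 - -(Ring.inverse (1 + z • N) * (w • N))) := by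
      rw [sub_neg_eq_add, mul_add, ← mul_assoc, Ring.mul_inverse_cancel _ hz]
      simp [add_smul, add_assoc]
    rw [h1]
    refine hz.mul (isUnit_one_sub_of_norm_lt_one ?_)
    rw [norm_neg]
    refine (norm_mul_le _ _).trans_lt ?_
    calc _ ≤ 1 * ‖w • N‖ := by gcongr; exact hinv z hz
      _ < 1 := by simpa using hw
  have hunit (z : ℂ) : IsUnit (1 + z • N) := by
    obtain ⟨m, hm⟩ := exists_nat_gt ‖z • N‖
    have hm0 : (0 : ℝ) < m := (norm_nonneg _).trans_lt hm
    have hw : ‖(z / m) • N‖ < 1 := by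
      rw [div_eq_inv_mul, mul_smul, norm_smul, norm_inv, RCLike.norm_natCast, inv_mul_lt_iff₀ hm0]
      simpa using hm
    have hk (k : ℕ) : IsUnit (1 + (k * (z / m)) • N) := by
      induction k with
      | zero => simp
      | succ k ih =>
        have := hstep _ _ hw ih
        push_cast
        rwa [add_mul, one_mul]
    have := hk m
    rwa [mul_div_cancel₀] at this
    exact_mod_cast hm0.ne'
  -- The inverse is now entire and bounded, so Liouville's theorem makes it constant.
  have hdiff : Differentiable ℂ fun z : ℂ => Ring.inverse (1 + z • N) := fun z =>
    (differentiableAt_inverse (hunit z)).comp z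
      (((differentiableAt_id).smul_const N).const_add 1)
  have hbd : Bornology.IsBounded (Set.range fun z : ℂ => Ring.inverse (1 + z • N)) := by
    rw [isBounded_iff_forall_norm_le]
    exact ⟨1, by rintro _ ⟨z, rfl⟩; exact hinv z (hunit z)⟩
  have h01 := hdiff.apply_eq_apply_of_bounded hbd 1 0
  simp only [one_smul, zero_smul, add_zero, Ring.inverse_one] at h01
  have h1 := Ring.mul_inverse_cancel _ (hunit 1)
  rw [one_smul, h01, mul_one] at h1
  simpa using h1

end BanachAlgebra

/-! ### Hermitian operators and numerical range -/

section Operators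

variable {E : Type*} [NormedAddCommGroup E] [NormedSpace ℂ E] [CompleteSpace E]

/-- A hermitian operator with nonnegative spectrum generates a contraction semigroup
`exp (-t T)`, up to the regularisation by `ε`. -/
theorem IsHermitianOperator.norm_exp_neg_add_apply_le {T : E →L[ℂ] E} (hT : IsHermitianOperator T)
    (hs : ∀ z ∈ spectrum ℂ T, ∃ r : ℝ, 0 ≤ r ∧ z = (r : ℂ)) {ε : ℝ} (hε : 0 < ε)
    {t : ℝ} (ht : 0 ≤ t) (x : E) :
    ‖NormedSpace.exp ((t : ℂ) • (-(T + (ε : ℂ) • 1))) x‖ ≤ ‖x‖ := by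
  nontriviality E
  let : NormedAlgebra ℚ (E →L[ℂ] E) := NormedAlgebra.restrictScalars ℚ ℂ _
  set A : E →L[ℂ] E := -(T + (ε : ℂ) • 1)
  -- `A = S - ρ`, where `S = ‖T‖ - T` has spectrum in `[0, ‖T‖]`. The `ε` puts `ρ` strictly above
  -- the spectral radius of `S`.
  let c : NNReal := ‖T‖₊
  let S : E →L[ℂ] E := algebraMap ℂ _ (c : ℂ) - T
  let ρ : NNReal := c + ⟨ε, hε.le⟩
  have hρ : (ρ : ℝ) = ‖T‖ + ε := rfl
  have hρc : ((ρ : ℝ) : ℂ) = ‖T‖ + ε := by rw [hρ]; push_cast; rfl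
  have hrad : spectralRadius ℂ S < ρ := by
    refine spectrum.spectralRadius_lt_of_forall_lt S fun z hz => ?_
    have hz' : (c : ℂ) - z ∈ spectrum ℂ T := by
      have := hz
      simp only [S] at this
      rw [← spectrum.singleton_sub_eq] at this
      obtain ⟨_, rfl, w, hw, rfl⟩ := this
      simpa using hw
    obtain ⟨r, hr, hzr⟩ := hs _ hz'
    have hrn : r ≤ ‖T‖ := by
      have := spectrum.norm_le_norm_of_mem hz'
      rw [hzr, Complex.norm_real, Real.norm_of_nonneg hr] at this
      exact this
    have hz2 : z = ((‖T‖ - r : ℝ) : ℂ) := by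
      have : z = (c : ℂ) - r := by rw [← hzr]; ring
      rw [this]; push_cast; rfl
    rw [← NNReal.coe_lt_coe, hρ, coe_nnnorm, hz2, Complex.norm_real,
      Real.norm_of_nonneg (by linarith)]
    linarith
  obtain ⟨C, hC⟩ := exists_norm_pow_le_of_spectralRadius_lt hrad
  have hexpA (s : ℝ) (hs : 0 ≤ s) : ‖NormedSpace.exp ((s : ℂ) • A)‖ ≤ C := by
    have h1 : (s : ℂ) • A = algebraMap ℂ _ (-(s * ρ : ℂ)) + (s : ℂ) • S := by
      ext y
      simp [A, S, Algebra.algebraMap_eq_smul_one, hρc, c]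
      module
    rw [h1, NormedSpace.exp_add_of_commute (Algebra.commutes _ _),
      ← NormedSpace.algebraMap_exp_comm]
    refine (norm_mul_le _ _).trans ?_
    rw [norm_algebraMap', ← Complex.exp_eq_exp_ℂ, Complex.norm_exp]
    have h2 := norm_exp_smul_le_of_norm_pow_le hC (s : ℂ)
    rw [Complex.norm_real, Real.norm_of_nonneg hs] at h2
    have h3 : (-(s * ρ : ℂ)).re = -(s * ρ) := by
      simp
    rw [h3]
    calc _ ≤ Real.exp (-(s * ρ)) * (C * Real.exp (s * ρ)) := by gcongr
      _ = C * (Real.exp (-(s * ρ)) * Real.exp (s * ρ)) := by ring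
      _ = C := by rw [← Real.exp_add]; simp
  have hdiff : Differentiable ℂ fun z : ℂ => NormedSpace.exp (z • A) x :=
    (differentiable_exp_smul_const ℂ A).clm_apply (differentiable_const x)
  have h0 : (0 : ℝ) ≤ ((t : ℂ)).re := by simpa using ht
  -- Boundedness by some constant on the positive real axis, together with the bound `‖x‖` on the
  -- imaginary axis (isometries up to a unimodular factor), gives the bound `‖x‖` on the whole
  -- half-plane.
  refine PhragmenLindelof.right_half_plane_of_bounded_on_real
    (f := fun z : ℂ => NormedSpace.exp (z • A) x) hdiff.diffContOnCl
    ⟨1, by norm_num, ‖A‖, ?_⟩ ?_ ?_ h0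
  · refine Asymptotics.IsBigO.of_bound ‖x‖ (Eventually.of_forall fun z => ?_)
    have h2 := norm_exp_smul_le_of_norm_pow_le (S := A) (C := 1) (ρ := ‖A‖)
      (fun n => by simpa using norm_pow_le A n) z
    rw [Real.rpow_one, Real.norm_of_nonneg (Real.exp_pos _).le]
    calc _ ≤ ‖NormedSpace.exp (z • A)‖ * ‖x‖ := ContinuousLinearMap.le_opNorm _ _
      _ ≤ (1 * Real.exp (‖z‖ * ‖A‖)) * ‖x‖ := by gcongr
      _ = _ := by rw [mul_comm ‖A‖]; ring
  · refine isBoundedUnder_of_eventually_le (a := C * ‖x‖) ?_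
    filter_upwards [eventually_ge_atTop 0] with s hs
    exact (ContinuousLinearMap.le_opNorm _ _).trans (by gcongr; exact hexpA s hs)
  · intro s
    have h1 : ((s : ℂ) * Complex.I) • A =
        algebraMap ℂ _ (-(s * ε * Complex.I : ℂ)) + (Complex.I * ((-s : ℝ) : ℂ)) • T := by
      ext y
      simp [A, Algebra.algebraMap_eq_smul_one]
      module
    rw [h1, NormedSpace.exp_add_of_commute (Algebra.commutes _ _),
      ← NormedSpace.algebraMap_exp_comm, Algebra.algebraMap_eq_smul_one,
      smul_mul_assoc, one_mul, smul_apply, norm_smul,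
      ← Complex.exp_eq_exp_ℂ, Complex.norm_exp]
    have h3 := (hT (-s)).norm_map_of_map_zero (map_zero _) x
    rw [h3]
    simp

/-- The function `Re f(exp(itT) x)` is maximal at `t = 0`, so its derivative there vanishes. -/
theorem IsHermitianOperator.im_apply_eq_zero {T : E →L[ℂ] E} (hT : IsHermitianOperator T)
    {x : E} {f : StrongDual ℂ E} (hf : ‖f‖ ≤ 1) (hfx : f x = ‖x‖) : (f (T x)).im = 0 := by
  have hd : HasDerivAt (fun t : ℝ => (f (NormedSpace.exp ((t : ℂ) • (Complex.I • T)) x)).re)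
      (f ((Complex.I • T) x)).re 0 := by
    have h1 := (hasDerivAt_exp_smul_const (𝕂 := ℂ) (Complex.I • T) 0)
    have h2 := (f.hasFDerivAt.comp_hasDerivAt (0 : ℂ) (h1.clm_apply (hasDerivAt_const (0 : ℂ) x)))
    have h3 := HasDerivAt.real_of_complex (z := 0) (by simpa using h2)
    simpa using h3
  have hmax : IsLocalMax
      (fun t : ℝ => (f (NormedSpace.exp ((t : ℂ) • (Complex.I • T)) x)).re) 0 := by
    refine Eventually.of_forall fun t => ?_
    have h3 := (hT t).norm_map_of_map_zero (map_zero _) x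
    simp only [smul_smul, mul_comm (_ : ℂ) Complex.I]
    refine (Complex.re_le_norm _).trans ((f.le_of_opNorm_le hf _).trans ?_)
    rw [h3]
    simp [hfx]
  have := hmax.hasDerivAt_eq_zero hd
  simpa using this

/-- Contractivity of the regularised semigroup makes the right derivative of `Re f(exp(tA) x)` at
`0` non-positive; then `ε` tends to `0`. -/
theorem IsHermitianOperator.re_apply_nonneg {T : E →L[ℂ] E} (hT : IsHermitianOperator T)
    (hs : ∀ z ∈ spectrum ℂ T, ∃ r : ℝ, 0 ≤ r ∧ z = (r : ℂ))
    {x : E} {f : StrongDual ℂ E} (hf : ‖f‖ ≤ 1) (hfx : f x = ‖x‖) : 0 ≤ (f (T x)).re := by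
  have key (ε : ℝ) (hε : 0 < ε) : 0 ≤ (f (T x)).re + ε * ‖x‖ := by
    set A : E →L[ℂ] E := -(T + (ε : ℂ) • 1)
    have hd : HasDerivAt (fun t : ℝ => (f (NormedSpace.exp ((t : ℂ) • A) x)).re)
        (f (A x)).re 0 := by
      have h1 := (hasDerivAt_exp_smul_const (𝕂 := ℂ) A 0)
      have h2 := (f.hasFDerivAt.comp_hasDerivAt (0 : ℂ) (h1.clm_apply (hasDerivAt_const (0 : ℂ) x)))
      have h3 := HasDerivAt.real_of_complex (z := 0) (by simpa using h2)
      simpa using h3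
    have hle : (f (A x)).re ≤ 0 := by
      have htend := hd.tendsto_slope_zero_right
      refine le_of_tendsto htend ?_
      filter_upwards [self_mem_nhdsWithin] with t ht
      have ht : 0 < t := ht
      have h4 : (f (NormedSpace.exp ((t : ℂ) • A) x)).re ≤ ‖x‖ :=
        (Complex.re_le_norm _).trans ((f.le_of_opNorm_le hf _).trans
          (by rw [one_mul]; exact hT.norm_exp_neg_add_apply_le hs hε ht.le x))
      simp only [zero_add, Complex.ofReal_zero, zero_smul, NormedSpace.exp_zero,
        one_apply_eq_self, hfx, Complex.ofReal_re, smul_eq_mul]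
      exact mul_nonpos_of_nonneg_of_nonpos (by positivity) (by linarith)
    simp [A, hfx] at hle
    linarith
  refine le_of_forall_pos_le_add fun δ hδ => ?_
  have h := key (δ / (‖x‖ + 1)) (by positivity)
  have : δ / (‖x‖ + 1) * ‖x‖ ≤ δ := by
    rw [div_mul_eq_mul_div, div_le_iff₀ (by positivity)]
    nlinarith [norm_nonneg x]
  linarith

/-- An operator on a complex Banach space with trivial numerical range vanishes. -/
theorem ContinuousLinearMap.eq_zero_of_norm_le_norm_add_smul {N : E →L[ℂ] E}
    (h : ∀ (z : ℂ) (x : E), ‖x‖ ≤ ‖x + z • N x‖) : N = 0 := by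
  refine eq_zero_of_norm_inverse_one_add_smul_le fun z hz => ?_
  refine ContinuousLinearMap.opNorm_le_bound _ zero_le_one fun y => ?_
  have h1 := h z (Ring.inverse (1 + z • N) y)
  have h2 : (1 + z • N) (Ring.inverse (1 + z • N) y) = y :=
    DFunLike.congr_fun (Ring.mul_inverse_cancel _ hz) y
  have h3 : (1 + z • N) (Ring.inverse (1 + z • N) y) =
    Ring.inverse (1 + z • N) y + z • N (Ring.inverse (1 + z • N) y) := rfl
  rw [← h3, h2] at h1
  rwa [one_mul]

end Operators

namespace JBStarTriple

variable {E : Type*} [NormedAddCommGroup E] [NormedSpace ℂ E] [CompleteSpace E] [JBStarTriple E]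

/-! ### Continuity of the triple product -/

theorem continuous_triple_self (a : E) : Continuous (triple a a) := by
  obtain ⟨T, hT, -⟩ := hermitian_nonneg a
  exact T.continuous.congr hT

/-- Polarization from the diagonal operators `L(a,a)`. -/
theorem continuous_triple_right (a b : E) : Continuous (triple a b) := by
  have h : ∀ x : E, triple a b x = (1 / 2 : ℂ) • ((triple (a + b) (a + b) x - triple a a x -
      triple b b x) + Complex.I • (triple (a + Complex.I • b) (a + Complex.I • b) x -
      triple a a x - triple b b x)) := by
    intro x
    simp only [map_add, map_smulₛₗ, LinearMap.add_apply, LinearMap.smul_apply, RingHom.id_apply,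
      Complex.conj_I, smul_add, smul_sub, smul_smul]
    match_scalars <;> ring_nf <;> simp [Complex.I_sq] <;> norm_num
  refine Continuous.congr ?_ fun x => (h x).symm
  have h1 := continuous_triple_self a
  have h2 := continuous_triple_self b
  have h3 := continuous_triple_self (a + b)
  have h4 := continuous_triple_self (a + Complex.I • b)
  fun_prop

theorem continuous_triple_left (b c : E) : Continuous fun a => triple a b c :=
  (continuous_triple_right c b).congr fun _ => triple_symm _ _ _

/-! ### Positive forms from norming functionals -/

theorem im_apply_triple_self {x : E} {f : StrongDual ℂ E} (hf : ‖f‖ ≤ 1) (hfx : f x = ‖x‖)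
    (a : E) : (f (triple a a x)).im = 0 := by
  obtain ⟨T, hT, hT', -⟩ := hermitian_nonneg a
  rw [← hT]
  exact hT'.im_apply_eq_zero hf hfx

theorem re_apply_triple_self_nonneg {x : E} {f : StrongDual ℂ E} (hf : ‖f‖ ≤ 1)
    (hfx : f x = ‖x‖) (a : E) : 0 ≤ (f (triple a a x)).re := by
  obtain ⟨T, hT, hT', hs⟩ := hermitian_nonneg a
  rw [← hT]
  exact hT'.re_apply_nonneg hs hf hfx

/-- For a functional `f` attaining its norm at `x`, the form `f {a, b, x}` is hermitian. -/
theorem apply_triple_eq_conj {x : E} {f : StrongDual ℂ E} (hf : ‖f‖ ≤ 1) (hfx : f x = ‖x‖)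
    (a b : E) : f (triple a b x) = starRingEnd ℂ (f (triple b a x)) := by
  have h0 := im_apply_triple_self hf hfx a
  have h1 := im_apply_triple_self hf hfx b
  have h2 := im_apply_triple_self hf hfx (a + b)
  have h3 := im_apply_triple_self hf hfx (a + Complex.I • b)
  simp only [map_add, map_smulₛₗ, LinearMap.add_apply, LinearMap.smul_apply, RingHom.id_apply,
    Complex.conj_I, smul_add, smul_eq_mul, Complex.add_im, Complex.mul_im, Complex.mul_re,
    Complex.I_re, Complex.I_im, Complex.neg_im, Complex.neg_re] at h2 h3
  apply Complex.ext
  · rw [Complex.conj_re]; linarith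
  · rw [Complex.conj_im]; linarith

/-- Cauchy–Schwarz in the degenerate case: if `{a, a, x} = 0`, then the functionals attaining
their norm at `x` annihilate `{b, a, x}` for every `b`. -/
theorem apply_triple_eq_zero {a x : E} (h : triple a a x = 0) {f : StrongDual ℂ E} (hf : ‖f‖ ≤ 1)
    (hfx : f x = ‖x‖) (b : E) : f (triple b a x) = 0 := by
  have key (b : E) : (f (triple b a x)).re = 0 := by
    have hc := congrArg Complex.re (apply_triple_eq_conj hf hfx a b)
    rw [Complex.conj_re] at hc
    -- The `t ^ 2` term vanishes, leaving an affine function of `t` bounded below, whose slope must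
    -- be zero.
    have hpos (t : ℝ) : 0 ≤ (f (triple b b x)).re + t * (2 * (f (triple b a x)).re) := by
      have h1 := re_apply_triple_self_nonneg hf hfx (b + (t : ℂ) • a)
      simp only [map_add, map_smulₛₗ, LinearMap.add_apply, LinearMap.smul_apply, RingHom.id_apply,
        Complex.conj_ofReal, smul_add, smul_eq_mul, Complex.add_re,
        Complex.re_ofReal_mul, h, map_zero, Complex.zero_re, smul_zero] at h1
      rw [hc] at h1
      linarith
    by_contra hne
    have h2 := hpos (-((f (triple b b x)).re + 1) / (2 * (f (triple b a x)).re))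
    rw [div_mul_cancel₀ _ (by simpa using hne)] at h2
    linarith
  apply Complex.ext
  · exact key b
  · have h1 := key (Complex.I • b)
    simpa using h1

/-- If `{b, a, ·}` leaves the kernel of `{a, a, ·}` invariant, it vanishes there. -/
theorem triple_eq_zero_of_invariant {a b : E} (h : ∀ x, triple a a x = 0 →
    triple a a (triple b a x) = 0) {x : E} (hx : triple a a x = 0) : triple b a x = 0 := by
  let K : Submodule ℂ E := LinearMap.ker (triple a a)
  have hK : IsClosed (K : Set E) := isClosed_singleton.preimage (continuous_triple_self a)
  have : CompleteSpace K := hK.completeSpace_coe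
  let N : K →L[ℂ] K := ⟨(triple b a).restrict h,
    ((continuous_triple_right b a).comp continuous_subtype_val).subtype_mk _⟩
  have hN : N = 0 := by
    refine ContinuousLinearMap.eq_zero_of_norm_le_norm_add_smul fun z y => ?_
    obtain ⟨f, hf, hfy⟩ := exists_dual_vector'' ℂ (y : E)
    have h1 : f ((y + z • N y : K) : E) = ‖(y : E)‖ := by
      change f ((y : E) + z • triple b a (y : E)) = _
      rw [map_add, map_smul, apply_triple_eq_zero y.2 hf hfy, smul_zero, add_zero]
      exact hfy
    have h2 := f.le_of_opNorm_le hf ((y + z • N y : K) : E)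
    rw [h1] at h2
    simpa using h2
  exact congrArg Subtype.val (DFunLike.congr_fun hN (⟨x, hx⟩ : K))

/-- Closed graph theorem for `b ↦ L(a,b)`: hermitian symmetry under norming functionals moves the
limit to the outer variable, so the difference of the two candidate limits has zero numerical range.
-/
theorem continuous_triple_middle (a c : E) : Continuous fun b => triple a b c := by
  let Φ : E →ₗ[ℝ] (E →L[ℂ] E) :=
    { toFun := fun b => ⟨triple a b, continuous_triple_right a b⟩
      map_add' := fun b c => by ext x; simp
      map_smul' := fun r b => by
        ext x
        change triple a (r • b) x = r • triple a b x
        rw [← Complex.coe_smul, map_smulₛₗ, Complex.conj_ofReal, LinearMap.smul_apply,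
          Complex.coe_smul] }
  have hΦ : Continuous Φ := by
    refine Φ.continuous_of_seq_closed_graph fun u b T hu hT => ?_
    have h0 : T - Φ b = 0 := by
      refine ContinuousLinearMap.eq_zero_of_norm_le_norm_add_smul fun z x => ?_
      obtain ⟨f, hf, hfx⟩ := exists_dual_vector'' ℂ x
      have h1 : Tendsto (fun n => f (triple a (u n) x)) atTop (𝓝 (f (T x))) :=
        (f.continuous.tendsto _).comp
          (((ContinuousLinearMap.apply ℂ E x).continuous.tendsto T).comp hT)
      have h2 : Tendsto (fun n => f (triple a (u n) x)) atTop (𝓝 (f (triple a b x))) := by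
        simp only [apply_triple_eq_conj hf hfx a]
        exact (Complex.continuous_conj.tendsto _).comp ((f.continuous.tendsto _).comp
          (((continuous_triple_left a x).tendsto b).comp hu))
      have h3 : f ((T - Φ b) x) = 0 := by
        change f (T x - triple a b x) = 0
        rw [map_sub, tendsto_nhds_unique h1 h2, sub_self]
      have h4 := f.le_of_opNorm_le hf (x + z • (T - Φ b) x)
      rw [map_add, map_smul, h3, smul_zero, add_zero, hfx] at h4
      simpa using h4
    exact sub_eq_zero.1 h0
  exact (ContinuousLinearMap.apply ℂ E c).continuous.comp hΦ

/-! ### Odd powers -/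

/-- Exchanging `y` and `z` in the Jordan identity gives two linear equations for the two nested
products; solving them yields the claim. -/
theorem triple_triple_self (x y z : E) :
    triple x y (triple x z x) = triple x (triple y x z) x := by
  have h1 := jordan_identity x y x z x
  have h2 := jordan_identity x z x y x
  rw [triple_symm (triple x y x) z x] at h1
  rw [triple_symm (triple x z x) y x, triple_symm z x y] at h2
  linear_combination (norm := module) (-1 / 3 : ℂ) • h1 + (-2 / 3 : ℂ) • h2

theorem triple_self_oddPow_succ (a : E) (k l : ℕ) :
    triple a (oddPow a l) (oddPow a (k + 1)) =
      triple a (triple (oddPow a l) a (oddPow a k)) a :=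
  triple_triple_self a (oddPow a l) (oddPow a k)

theorem triple_oddPow (a : E) (k l m : ℕ) :
    triple (oddPow a k) (oddPow a l) (oddPow a m) = oddPow a (k + l + m + 1) := by
  induction h : k + l + m using Nat.strong_induction_on generalizing k l m with
  | _ N ih =>
  subst h
  have key (k' l' : ℕ) (h : k' + l' < k + l + m) :
      triple a (oddPow a l') (oddPow a (k' + 1)) = oddPow a (k' + l' + 2) := by
    rw [triple_self_oddPow_succ]
    have := ih (l' + 0 + k') (by omega) l' 0 k' rfl
    rw [show oddPow a 0 = a from rfl] at this
    rw [this, show k' + l' + 2 = (l' + 0 + k' + 1) + 1 by omega]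
    rfl
  rcases m with _ | m
  · rcases k with _ | k
    · simp [oddPow]
    · rw [triple_symm, show oddPow a 0 = a from rfl, key k l (by omega)]
      congr 1
      omega
  · have h1 := ih (k + l + 0) (by omega) k l 0 rfl
    have h2 := ih (l + k + m) (by omega) l k m rfl
    have h3 := key (k + l) m (by omega)
    rw [show oddPow a 0 = a from rfl] at h1
    -- By induction all three terms on the right are the same odd power, with signs `+`, `-`, `+`.
    have h4 := jordan_identity (oddPow a k) (oddPow a l) a (oddPow a m) a
    rw [h1, h2, triple_symm (oddPow a (k + l + 0 + 1)), add_zero, h3] at h4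
    have h5 : triple a (oddPow a (l + k + m + 1)) a = oddPow a (k + l + m + 2) := by
      rw [add_comm l k]; rfl
    rw [h5, sub_self, zero_add] at h4
    exact h4

/-- Computing the commutator of `L(a^[2i+1], a)` and `L(a, a^[2n+1])` in both orders shows that `g`
is an arithmetic progression with difference `g 0 - g N`. Its last term then forces `(N + 1) • (g 0
- g N) = 0`, so `g` is constant. -/
theorem triple_oddPow_eq (a : E) (k l : ℕ) (x : E) :
    triple (oddPow a k) (oddPow a l) x = triple (oddPow a (k + l)) a x := by
  set N := k + l with hN
  let g : ℕ → E := fun i => triple (oddPow a i) (oddPow a (N - i)) x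
  have step (i : ℕ) (hi : i < N) : g (i + 1) = g i + (g 0 - g N) := by
    obtain ⟨n, hn⟩ : ∃ n, N = i + n + 1 := ⟨N - i - 1, by omega⟩
    have h1 := jordan_identity (oddPow a i) a a (oddPow a n) x
    have h2 := jordan_identity a (oddPow a n) (oddPow a i) a x
    have e1 := triple_oddPow a i 0 0
    have e2 := triple_oddPow a 0 i n
    have e3 := triple_oddPow a 0 n i
    have e4 := triple_oddPow a n 0 0
    simp only [add_zero, zero_add, show oddPow a 0 = a from rfl] at e1 e2 e3 e4
    rw [e1, e2] at h1
    rw [e3, e4] at h2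
    have g1 : g (i + 1) = triple (oddPow a (i + 1)) (oddPow a n) x := by
      simp only [g]; congr; omega
    have g2 : g i = triple (oddPow a i) (oddPow a (n + 1)) x := by
      simp only [g]; congr; omega
    have g3 : g 0 = triple a (oddPow a (i + n + 1)) x := by
      simp only [g]; congr
    have g4 : g N = triple (oddPow a (n + i + 1)) a x := by
      simp only [g, Nat.sub_self]; rw [hn, add_comm i n]; rfl
    rw [g1, g2, g3, g4]
    linear_combination (norm := module) (-1 : ℂ) • h1 - (1 : ℂ) • h2
  have hg (i : ℕ) (hi : i ≤ N) : g i = g 0 + (i : ℂ) • (g 0 - g N) := by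
    induction i with
    | zero => simp
    | succ i ih =>
      rw [step i hi, ih (by omega)]
      push_cast
      module
  have hd : g 0 - g N = 0 := by
    have h1 : ((N : ℂ) + 1) • (g 0 - g N) = 0 := by
      linear_combination (norm := module) (-1 : ℂ) • hg N le_rfl
    exact (smul_eq_zero.1 h1).resolve_left (Nat.cast_add_one_ne_zero N)
  have h1 := (hg k (by omega)).trans (hg N le_rfl |>.trans (by rw [hd, smul_zero, smul_zero])).symm
  simp only [g, Nat.sub_self, show N - k = l by omega] at h1
  exact h1

theorem triple_oddPow_eq_zero {a x : E} (hx : triple a a x = 0) (k l : ℕ) :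
    triple (oddPow a k) (oddPow a l) x = 0 := by
  rw [triple_oddPow_eq]
  refine triple_eq_zero_of_invariant (fun y hy => ?_) hx
  have e1 := triple_oddPow a 0 0 (k + l)
  have e2 := triple_oddPow_eq a (k + l) 1 y
  simp only [add_zero, zero_add, show oddPow a 0 = a from rfl] at e1
  -- The commutator with `L(a,a)` is a difference of two operators that `triple_oddPow_eq`
  -- identifies.
  rw [jordan_identity, e1, hy, map_zero, add_zero, ← e2]
  exact sub_self _

/-! ### The generated subtriple -/

/-- The closed linear span of the odd powers of `a`. -/
noncomputable def oddPowClosure (a : E) : Submodule ℂ E :=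
  (Submodule.span ℂ (Set.range (oddPow a))).topologicalClosure

theorem isClosed_oddPowClosure (a : E) : IsClosed (oddPowClosure a : Set E) :=
  Submodule.isClosed_topologicalClosure _

theorem oddPow_mem_oddPowClosure (a : E) (k : ℕ) : oddPow a k ∈ oddPowClosure a :=
  Submodule.le_topologicalClosure _ (Submodule.subset_span ⟨k, rfl⟩)

theorem oddPowClosure_le {a : E} {T : Submodule ℂ E} (hT : IsClosed (T : Set E))
    (h : ∀ k, oddPow a k ∈ T) : oddPowClosure a ≤ T :=
  Submodule.topologicalClosure_minimal _ (Submodule.span_le.2 (by rintro _ ⟨k, rfl⟩; exact h k)) hT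

theorem triple_mem_of_oddPow_left {a y z : E} {T : Submodule ℂ E} (hT : IsClosed (T : Set E))
    (h : ∀ k, triple (oddPow a k) y z ∈ T) {b : E} (hb : b ∈ oddPowClosure a) :
    triple b y z ∈ T := by
  rw [triple_symm]
  exact oddPowClosure_le (T := T.comap (triple z y))
    (hT.preimage (continuous_triple_right z y))
    (fun k => by rw [Submodule.mem_comap, triple_symm]; exact h k) hb

theorem triple_mem_of_oddPow_middle {a x z : E} {T : Submodule ℂ E} (hT : IsClosed (T : Set E))
    (h : ∀ k, triple x (oddPow a k) z ∈ T) {b : E} (hb : b ∈ oddPowClosure a) :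
    triple x b z ∈ T :=
  oddPowClosure_le (T := T.comap ((triple x).flip z))
    (hT.preimage (continuous_triple_middle x z)) h hb

theorem isSubtriple_oddPowClosure (a : E) : IsSubtriple (oddPowClosure a) := by
  have hcl := isClosed_oddPowClosure a
  refine ⟨hcl, fun x hx y hy z hz => ?_⟩
  refine triple_mem_of_oddPow_left hcl (fun k => ?_) hx
  refine triple_mem_of_oddPow_middle hcl (fun l => ?_) hy
  rw [triple_symm]
  refine triple_mem_of_oddPow_left hcl (fun m => ?_) hz
  rw [triple_oddPow]
  exact oddPow_mem_oddPowClosure a _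

theorem generated_le_oddPowClosure (a : E) : generated a ≤ oddPowClosure a :=
  sInf_le ⟨isSubtriple_oddPowClosure a, oddPow_mem_oddPowClosure a 0⟩

theorem isSubtriple_generated (a : E) : IsSubtriple (generated a) := by
  constructor
  · rw [generated, Submodule.coe_sInf]
    exact isClosed_biInter fun S hS => hS.1.1
  · intro x hx y hy z hz
    simp only [generated, Submodule.mem_sInf] at *
    exact fun S hS => hS.1.2 x (hx S hS) y (hy S hS) z (hz S hS)

/-- If `{a, a, x} = 0`, then `{b, c, x} = 0` for all `b`, `c` in the subtriple generated by `a`. -/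
theorem triple_eq_zero_of_mem_generated {a x : E} (hx : triple a a x = 0) {b c : E}
    (hb : b ∈ generated a) (hc : c ∈ generated a) : triple b c x = 0 := by
  have hcl : IsClosed ((⊥ : Submodule ℂ E) : Set E) := by
    rw [Submodule.bot_coe]; exact isClosed_singleton
  refine (Submodule.mem_bot ℂ).1 ?_
  refine triple_mem_of_oddPow_left hcl (fun k => ?_) (generated_le_oddPowClosure a hb)
  refine triple_mem_of_oddPow_middle hcl (fun l => ?_) (generated_le_oddPowClosure a hc)
  exact (Submodule.mem_bot ℂ).2 (triple_oddPow_eq_zero hx k l)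

theorem Q_Q_eq_zero_of_mem_generated {a x : E} (hx : triple a a x = 0) {b c : E}
    (hb : b ∈ generated a) (hc : c ∈ generated a) : Q b (Q c x) = 0 := by
  have hbcb := (isSubtriple_generated a).2 b hb c hc b hb
  -- Every term except `{b, {c,x,c}, b}` contains a product already known to vanish.
  have h := jordan_identity x c b c b
  rw [triple_symm x c (triple b c b), triple_eq_zero_of_mem_generated hx hbcb hc,
    triple_symm x c b, triple_eq_zero_of_mem_generated hx hb hc] at h
  simpa [Q] using h

theorem triple_oddPow_one_middle_eq_zero {a x : E} (hx : triple a a x = 0) :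
    triple (oddPow a 1) x (oddPow a 1) = 0 := by
  change triple (triple a a a) x (triple a a a) = 0
  have h1 : triple (triple a a a) x a = 0 := by
    -- With `W = {a^[3],x,a}` and `V = {a,a,{a,x,a}}`, the two identities read `W = 2V` and `V =
    -- 2W`.
    have h2 := jordan_identity a x a a a
    have h3 := jordan_identity a a a x a
    rw [triple_symm x a a, hx, triple_symm (triple a x a) a a, triple_symm a x (triple a a a),
      map_zero, LinearMap.zero_apply] at h2
    rw [hx, triple_symm a x (triple a a a), map_zero, LinearMap.zero_apply] at h3
    linear_combination (norm := module) (-1 / 3 : ℂ) • h2 + (-2 / 3 : ℂ) • h3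
  have h2 : triple x (triple a a a) a = 0 := by
    rw [triple_symm]; exact triple_oddPow_eq_zero hx 0 1
  rw [jordan_identity, h1, h2]
  simp

end JBStarTriple

theorem lemma1 {E : Type*} [NormedAddCommGroup E] [NormedSpace ℂ E] [CompleteSpace E]
    [JBStarTriple E] (e : E) (he : JBStarTriple.IsTripotent e)
    (a : E) (ha : a ∈ JBStarTriple.peirce e 1) (haae : JBStarTriple.triple a a e = 0) :
    (∀ b ∈ JBStarTriple.generated a, ∀ c ∈ JBStarTriple.generated a,
      JBStarTriple.triple b c e = 0 ∧ JBStarTriple.Q b (JBStarTriple.Q c e) = 0) ∧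
    -- here `oddPow a 1` is `a^[3] = {a, a, a}`
    JBStarTriple.triple (JBStarTriple.oddPow a 1) e (JBStarTriple.oddPow a 1) = 0 :=
  ⟨fun _ hb _ hc => ⟨JBStarTriple.triple_eq_zero_of_mem_generated haae hb hc,
    JBStarTriple.Q_Q_eq_zero_of_mem_generated haae hb hc⟩,
    JBStarTriple.triple_oddPow_one_middle_eq_zero haae⟩
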